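/- **Proposition (Diffuse barycenters in $\mathbb{R}^d$).** Let $d \ge 1$ be an integer and $\kappa, L \in (0,\infty)$. Write $\mathrm{Cos}(s) := \cos(\min\{|s|,\pi/2\})$ and let $\Omega := \bar B(0, L+\kappa\pi/2) \subset \mathbb{R}^d$ be the closed Euclidean ball. For finite nonnegative Borel measures $\mu,\nu$ on $\Omega$ let $$\mathrm{HK}_\kappa^2(\mu,\nu) := \inf_{\gamma} \left\{ \int_{\Omega^2} \hat c_\kappa \, d\gamma + \mathrm{KL}(P_1\gamma|\mu) + \mathrm{KL}(P_2\gamma|\nu) \right\},$$ where the infimum runs over the finite nonnegative Borel measures $\gamma$ on $\Omega^2$ with marginals $P_1\gamma, P_2\gamma$, where $\hat c_\kappa(x,y) := -2\log\cos(|x-y|/\kappa)$ if $|x-y| \le \kappa\pi/2$ (with $-2 \log 0 := +\infty$) and $\hat c_\kappa(x,y) := +\infty$ otherwise, and where $\mathrm{KL}(\alpha|\beta) := \int \varphi(\frac{d\alpha}{d\beta})\,d\beta$ with $\varphi(s) := s\log s - s + 1$, $\varphi(0) := 1$, if $\alpha \ll \beta$, and $\mathrm{KL}(\alpha|\beta)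 := +\infty$ otherwise. For a probability measure $\rho$ on $\Omega$ consider the barycenter problem of minimizing $$J_{\rho,\kappa}(\nu) := \int_\Omega \mathrm{HK}_\kappa^2(\delta_x,\nu)\,d\rho(x) \tag{$\mathcal{P}_{\rho,\kappa}$}$$ over all finite nonnegative Borel measures $\nu$ on $\Omega$. Define $\sigma \ge 0$ on $\Omega$ by $\sigma^2(x) := \int_{B(0,L)} \mathrm{Cos}^2(|x-y|/\kappa)\,dy$, let $a := 1/\int_\Omega \sigma(x)\,dx$, let $C_d := \int_{\mathbb{R}^d} \mathrm{Cos}^2(|z|)\,dz$, and let $\rho := a\,\sigma\,\mathcal{L}^d$ on $\Omega$, where $\mathcal{L}^d$ is Lebesgue measure. Then: 1. $\rho$ is a probability measure on $\Omega$; 2. the measure $C_d^2\,\kappa^{2d}\,a^2 \cdot \mathcal{L}^d|_{B(0,L)}$ is a minimizer of $(\mathcal{P}_{\rho,\kappa})$, and it is the only one; 3. $(\mathcal{P}_{\rho,\kappa})$ has no discrete minimizer, that is, no minimizer is concentrated on a countable set. In particular, for every $d \ge 1$ and $\kappa > 0$ there are a compact convex set $\Omega \subset \mathbb{R}^d$ (a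 closed ball) and a probability measure $\rho$ on $\Omega$ such that $(\mathcal{P}_{\rho,\kappa})$ has no discrete minimizer. -/

import Mathlib

open MeasureTheory

noncomputable section

namespace HKBary

/-- The truncated cosine `Cos(s) = cos (min {|s|, π/2})`. -/
def truncCos (s : ℝ) : ℝ := Real.cos (min |s| (Real.pi / 2))

/-- The transport cost `-2 log cos (|x - y| / κ)` for `|x - y| ≤ κ π / 2`, and `+∞` beyond.
At `|x - y| = κ π / 2` the cosine vanishes and `-2 log 0 = +∞`; since `Real.log 0 = 0`, this
borderline case is placed in the second branch. -/
def cost {X : Type*} [MetricSpace X] (κ : ℝ) (x y : X) : ENNReal :=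
  if dist x y < κ * Real.pi / 2 then
    ENNReal.ofReal (-2 * Real.log (Real.cos (dist x y / κ)))
  else ⊤

/-- The squared Hellinger-Kantorovich distance with length scale `κ` of two finite measures on `X`:
the infimum, over all finite measures `γ` on `X × X`, of the transport cost plus the Kullback-Leibler
divergences of the two marginals of `γ` with respect to `μ` and `ν`. (`klDiv` is the divergence
`∫ φ (dα/dβ) dβ` with `φ s = s log s - s + 1`, and `+∞` without absolute continuity.) -/
def hkSq {X : Type*} [MetricSpace X] [MeasurableSpace X] (κ : ℝ) (μ ν : Measure X) : ENNReal :=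
  ⨅ γ : FiniteMeasure (X × X),
    (∫⁻ p, cost κ p.1 p.2 ∂(γ : Measure (X × X)))
      + InformationTheory.klDiv ((γ : Measure (X × X)).map Prod.fst) μ
      + InformationTheory.klDiv ((γ : Measure (X × X)).map Prod.snd) ν

/-- The barycenter objective `J_{ρ,κ}(ν) = ∫ HK_κ²(δ_x, ν) dρ(x)`. -/
def objective {X : Type*} [MetricSpace X] [MeasurableSpace X] (κ : ℝ) (ρ ν : Measure X) : ENNReal :=
  ∫⁻ x, hkSq κ (Measure.dirac x) ν ∂ρ

/-- `ν` is a minimizer of `J_{ρ,κ}` among all finite nonnegative measures on `X`. -/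
def IsMinimizer {X : Type*} [MetricSpace X] [MeasurableSpace X] (κ : ℝ) (ρ ν : Measure X) : Prop :=
  IsFiniteMeasure ν ∧
    ∀ ν' : Measure X, IsFiniteMeasure ν' → objective κ ρ ν ≤ objective κ ρ ν'

/-- A measure is discrete if it is concentrated on a countable set, i.e. if it is a finite or
countable superposition of Dirac measures. -/
def IsDiscrete {X : Type*} [MeasurableSpace X] (ν : Measure X) : Prop :=
  ∃ S : Set X, S.Countable ∧ ν Sᶜ = 0

/-- The domain `Ω`: the closed ball in `ℝ^d` around `0` with radius `L + κ π / 2`. -/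
abbrev domain (d : ℕ) (κ L : ℝ) : Set (EuclideanSpace ℝ (Fin d)) :=
  Metric.closedBall 0 (L + κ * Real.pi / 2)

/-- Lebesgue measure of `ℝ^d` on `Ω`: the measure of `A ⊆ Ω` is the Lebesgue measure of `A`
as a subset of `ℝ^d`. -/
def lebesgue (d : ℕ) (κ L : ℝ) : Measure (domain d κ L) :=
  Measure.comap Subtype.val (volume : Measure (EuclideanSpace ℝ (Fin d)))

/-- The function `σ`, with `σ²(x) = ∫_{B(0,L)} Cos² (|x - y| / κ) dy`. -/
def sigma (d : ℕ) (κ L : ℝ) (x : EuclideanSpace ℝ (Fin d)) : ℝ :=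
  Real.sqrt (∫ y in Metric.ball (0 : EuclideanSpace ℝ (Fin d)) L, truncCos (‖x - y‖ / κ) ^ 2)

/-- The normalization `a = 1 / ‖σ‖_{L¹(Ω)}`. -/
def normConst (d : ℕ) (κ L : ℝ) : ℝ :=
  1 / ∫ x in domain d κ L, sigma d κ L x

/-- The measure `ρ = a · σ · Lebesgue` on `Ω`. -/
def rho (d : ℕ) (κ L : ℝ) : Measure (domain d κ L) :=
  (lebesgue d κ L).withDensity
    fun x => ENNReal.ofReal (normConst d κ L * sigma d κ L x)

/-- The constant `C_d`, the integral of `Cos² (|z|)` over `ℝ^d`. -/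
def cosMass (d : ℕ) : ℝ :=
  ∫ z : EuclideanSpace ℝ (Fin d), truncCos ‖z‖ ^ 2

/-- The measure `C_d² κ^{2d} a² · Lebesgue` restricted to `B(0,L)`, as a measure on `Ω`. -/
def diffuseMeasure (d : ℕ) (κ L : ℝ) : Measure (domain d κ L) :=
  ENNReal.ofReal (cosMass d ^ 2 * κ ^ (2 * d) * normConst d κ L ^ 2) •
    (lebesgue d κ L).restrict
      {x | (x : EuclideanSpace ℝ (Fin d)) ∈ Metric.ball (0 : EuclideanSpace ℝ (Fin d)) L}

end HKBary

end

/-! ### Pointwise entropy inequalities. -/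

namespace HKBary

open InformationTheory Real

/-! Write `P_ν(x) = ∫ Cos²(|x-y|/κ) dν(y)` (`potential`) and `K = C_d κ^d`. Duality for a Dirac
source gives the closed form `HK²(δ_x, ν) = 1 + ν(Ω) - 2 √P_ν(x)` (`hkSq_dirac`), so the objective
is `1 + ν(Ω) - 2a ∫_Ω √P_ν σ`.

By Fubini `∫_{ℝ^d} P_ν = K ν(Ω)`. Replacing the mass by this integral and completing the square
(`energy_eq`) turns the objective into a constant plus `K⁻¹ ∫_{Ωᶜ} P_ν + K⁻¹ ∫_Ω (√P_ν - K a σ)²`.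
Both terms vanish for `ν = (K a)² 𝓛|_{B(0,L)}`, because `σ²` is the potential of `𝓛|_{B(0,L)}` and
vanishes outside `Ω`.

Any other minimizer has the same potential almost everywhere on `ℝ^d`. The potential is a
convolution with a compactly supported kernel, whose characteristic function is analytic along rays
and so has isolated zeros there; hence it determines the measure (`eq_of_potential_ae_eq`). The
unique minimizer is a positive multiple of Lebesgue measure on a ball, which no countable set
carries. -/

lemma truncCos_nonneg (s : ℝ) : 0 ≤ truncCos s := by
  refine cos_nonneg_of_mem_Icc ⟨?_, min_le_right _ _⟩
  exact le_trans (by linarith [pi_pos]) (le_min (abs_nonneg s) pi_div_two_pos.le)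

lemma truncCos_le_one (s : ℝ) : truncCos s ≤ 1 := cos_le_one _

@[fun_prop]
lemma continuous_truncCos : Continuous truncCos := by
  unfold truncCos; fun_prop

lemma truncCos_zero : truncCos 0 = 1 := by
  simp [truncCos, pi_div_two_pos.le]

lemma truncCos_eq_cos {s : ℝ} (h0 : 0 ≤ s) (h : s < π / 2) : truncCos s = cos s := by
  rw [truncCos, abs_of_nonneg h0, min_eq_left h.le]

lemma truncCos_eq_zero {s : ℝ} (h : π / 2 ≤ s) : truncCos s = 0 := by
  rw [truncCos, min_eq_right (h.trans (le_abs_self s)), cos_pi_div_two]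

lemma truncCos_sq_le_one (s : ℝ) : truncCos s ^ 2 ≤ 1 :=
  pow_le_one₀ (truncCos_nonneg s) (truncCos_le_one s)

/-- Fenchel's inequality for `klFun`. -/
lemma klFun_add_exp_ge (s u : ℝ) (hs : 0 ≤ s) : 1 + s * u ≤ klFun s + exp u := by
  rw [klFun_apply]
  rcases hs.eq_or_lt with rfl | hs
  · simp [(exp_pos u).le]
  · have h := add_one_le_exp (u - log s)
    rw [exp_sub, exp_log hs, le_div_iff₀ hs] at h
    nlinarith

/-- Fenchel's inequality at the slope `u = log (t cos² θ)`, which absorbs the transport cost. -/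
lemma klFun_add_cost_ge {t θ s : ℝ} (ht : 0 < t) (hs : 0 ≤ s) (hθ : 0 < cos θ) :
    1 + s * log t ≤ klFun s + s * (-2 * log (cos θ)) + t * cos θ ^ 2 := by
  have h := klFun_add_exp_ge s (log t + 2 * log (cos θ)) hs
  rw [exp_add, exp_log ht, show 2 * log (cos θ) = log (cos θ ^ 2) by simp,
    exp_log (by positivity)] at h
  simp only [log_pow, Nat.cast_ofNat] at h
  linarith

/-- The equality case `s = t cos² θ` of `klFun_add_cost_ge`; it dictates the density of the optimal
plan. -/
lemma klFun_add_cost_eq {t θ : ℝ} (ht : 0 < t) (hθ : 0 < cos θ) :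
    klFun (t * cos θ ^ 2) + t * cos θ ^ 2 * (-2 * log (cos θ)) =
      t * cos θ ^ 2 * log t + 1 - t * cos θ ^ 2 := by
  rw [klFun_apply, log_mul ht.ne' (by positivity), log_pow]
  push_cast
  ring

/-! ### Closed form of the distance to a Dirac measure. -/

variable {X : Type*} [MetricSpace X] {κ : ℝ}

lemma dist_div_lt {x y : X} (hκ : 0 < κ) : dist x y < κ * π / 2 ↔ dist x y / κ < π / 2 := by
  rw [div_lt_iff₀ hκ]
  constructor <;> intro h <;> linarith

lemma cost_of_lt {x y : X} (h : dist x y < κ * π / 2) :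
    cost κ x y = ENNReal.ofReal (-2 * log (cos (dist x y / κ))) := if_pos h

lemma cost_of_not_lt {x y : X} (h : ¬ dist x y < κ * π / 2) : cost κ x y = ⊤ := if_neg h

lemma cos_pos_of_lt {x y : X} (hκ : 0 < κ) (h : dist x y < κ * π / 2) :
    0 < cos (dist x y / κ) := by
  rw [dist_div_lt hκ] at h
  have : 0 ≤ dist x y / κ := by positivity
  exact cos_pos_of_mem_Ioo ⟨by linarith [pi_pos], h⟩

lemma neg_two_log_cos_nonneg {x y : X} (hκ : 0 < κ) (h : dist x y < κ * π / 2) :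
    0 ≤ -2 * log (cos (dist x y / κ)) := by
  have := log_nonpos (cos_pos_of_lt hκ h).le (cos_le_one _)
  linarith

lemma continuous_kernel (x : X) : Continuous fun y => truncCos (dist x y / κ) ^ 2 := by
  fun_prop

variable [MeasurableSpace X]

/-- The potential `x ↦ ∫ Cos² (dist x y / κ) dν(y)`. -/
noncomputable def potential (κ : ℝ) (ν : Measure X) (x : X) : ℝ :=
  ∫ y, truncCos (dist x y / κ) ^ 2 ∂ν

lemma potential_nonneg (κ : ℝ) (ν : Measure X) (x : X) : 0 ≤ potential κ ν x :=
  integral_nonneg fun _ => by positivity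

variable [BorelSpace X]

lemma measurable_cost (x : X) : Measurable (cost κ x) := by
  unfold cost
  refine Measurable.ite ?_ ?_ measurable_const
  · exact measurableSet_lt (by fun_prop) measurable_const
  · have : Measurable fun y : X => dist x y := (continuous_const.dist continuous_id).measurable
    fun_prop

lemma integrable_kernel (ν : Measure X) [IsFiniteMeasure ν] (x : X) :
    Integrable (fun y => truncCos (dist x y / κ) ^ 2) ν := by
  refine Integrable.of_bound (C := 1) (continuous_kernel x).measurable.aestronglyMeasurable ?_
  refine .of_forall fun y => ?_
  rw [norm_of_nonneg (by positivity)]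
  exact truncCos_sq_le_one _

lemma potential_le (ν : Measure X) [IsFiniteMeasure ν] (x : X) :
    potential κ ν x ≤ ν.real Set.univ := by
  have := integral_mono (integrable_kernel (κ := κ) ν x) (integrable_const 1)
    fun y => truncCos_sq_le_one _
  simpa [potential] using this

/-- Since `Cos² ≤ 1`, AM-GM applies with `P_ν ≤ ν(X)`. It ensures that `ENNReal.ofReal` truncates
nothing in `hkSq_dirac`. -/
lemma two_sqrt_potential_le (ν : Measure X) [IsFiniteMeasure ν] (x : X) :
    2 * √(potential κ ν x) ≤ 1 + ν.real Set.univ := by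
  nlinarith [sq_nonneg (√(potential κ ν x) - 1), sq_sqrt (potential_nonneg κ ν x),
    potential_le (κ := κ) ν x]

/-- Weak duality with the parameter `t`: `klFun_add_cost_ge` integrated against `ν` contributes
`α(X) log t`, and Fenchel's inequality for the mass of the source marginal contributes `-α(X) log
t`. -/
lemma entropy_transport_dirac_ge (hκ : 0 < κ) (ν α : Measure X) [IsFiniteMeasure ν]
    [IsFiniteMeasure α] (x : X) {t : ℝ} (ht : 0 < t) :
    ENNReal.ofReal (1 + ν.real Set.univ - t * potential κ ν x - 1 / t) ≤
      (∫⁻ y, cost κ x y ∂α) + ENNReal.ofReal (klFun (α.real Set.univ)) + klDiv α ν := by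
  by_cases hkl : klDiv α ν = ⊤
  · simp [hkl]
  by_cases hc : (∫⁻ y, cost κ x y ∂α) = ⊤
  · simp [hc]
  obtain ⟨hac, hint⟩ := klDiv_ne_top_iff.1 hkl
  have hcm := measurable_cost (κ := κ) x
  set f : X → ℝ := fun y => (α.rnDeriv ν y).toReal with hf
  have hcfin : ∀ᵐ y ∂α, cost κ x y < ⊤ := ae_lt_top hcm hc
  have hαf : α = ν.withDensity (α.rnDeriv ν) := (Measure.withDensity_rnDeriv_eq α ν hac).symm
  -- Finiteness of the cost holds `α`-a.e., so with respect to `ν` only where the density is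
  -- nonzero.
  have hcf : ∀ᵐ y ∂ν, f y ≠ 0 → cost κ x y < ⊤ := by
    rw [hαf, ae_withDensity_iff (Measure.measurable_rnDeriv α ν)] at hcfin
    filter_upwards [hcfin] with y hy h0
    exact hy fun h => h0 (by simp [hf, h])
  have hfint : Integrable f ν := Measure.integrable_toReal_rnDeriv
  have hfI : ∫ y, f y ∂ν = α.real Set.univ := Measure.integral_toReal_rnDeriv hac
  have hkint : Integrable (fun y => klFun (f y)) ν := integrable_klFun_rnDeriv_iff hac |>.2 hint
  have hcint : Integrable (fun y => (cost κ x y).toReal) α :=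
    integrable_toReal_of_lintegral_ne_top hcm.aemeasurable hc
  have hcint' : Integrable (fun y => f y * (cost κ x y).toReal) ν := by
    have := (integrable_rnDeriv_smul_iff hac).2 hcint
    simpa [smul_eq_mul] using this
  have hcI : ∫ y, f y * (cost κ x y).toReal ∂ν = (∫⁻ y, cost κ x y ∂α).toReal := by
    rw [← integral_toReal hcm.aemeasurable hcfin, ← integral_rnDeriv_smul hac]
    simp [hf]
  have hpt : ∀ᵐ y ∂ν, 1 + f y * log t ≤
      klFun (f y) + f y * (cost κ x y).toReal + t * truncCos (dist x y / κ) ^ 2 := by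
    filter_upwards [hcf] with y hy
    by_cases h : dist x y < κ * π / 2
    · rw [cost_of_lt h, ENNReal.toReal_ofReal (neg_two_log_cos_nonneg hκ h),
        truncCos_eq_cos (by positivity) ((dist_div_lt hκ).1 h)]
      exact klFun_add_cost_ge ht ENNReal.toReal_nonneg (cos_pos_of_lt hκ h)
    · have h0 : f y = 0 := by
        by_contra h0
        simpa [cost_of_not_lt h] using hy h0
      rw [h0, klFun_zero]
      have : 0 ≤ t * truncCos (dist x y / κ) ^ 2 := by positivity
      linarith
  have hmono := integral_mono_ae ((integrable_const 1).add (hfint.mul_const (log t)))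
    ((hkint.add hcint').add ((integrable_kernel (κ := κ) ν x).const_mul t)) hpt
  simp only [Pi.add_apply] at hmono
  rw [integral_add (integrable_const 1) (hfint.mul_const _), integral_mul_const,
    integral_add (f := fun y => klFun (f y) + f y * (cost κ x y).toReal) (hkint.add hcint')
      ((integrable_kernel (κ := κ) ν x).const_mul t),
    integral_add hkint hcint', integral_const_mul, hfI, hcI,
    ← toReal_klDiv_eq_integral_klFun hac] at hmono
  have hm := klFun_add_exp_ge (α.real Set.univ) (-log t) measureReal_nonneg
  rw [exp_neg, exp_log ht, ← one_div] at hm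
  rw [← ENNReal.ofReal_toReal hc, ← ENNReal.ofReal_toReal hkl,
    ← ENNReal.ofReal_add ENNReal.toReal_nonneg (klFun_nonneg measureReal_nonneg),
    ← ENNReal.ofReal_add (add_nonneg ENNReal.toReal_nonneg (klFun_nonneg measureReal_nonneg))
      ENNReal.toReal_nonneg]
  refine ENNReal.ofReal_le_ofReal ?_
  simp only [integral_const, smul_eq_mul, mul_one] at hmono
  unfold potential
  linarith

/-- The dual bound is best at `t = 1/√P`; for `P = 0` it is approached only as `t → ∞`, whence the
`ε`. -/
lemma entropy_transport_dirac_ge_sqrt (hκ : 0 < κ) (ν α : Measure X) [IsFiniteMeasure ν]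
    [IsFiniteMeasure α] (x : X) :
    ENNReal.ofReal (1 + ν.real Set.univ - 2 * √(potential κ ν x)) ≤
      (∫⁻ y, cost κ x y ∂α) + ENNReal.ofReal (klFun (α.real Set.univ)) + klDiv α ν := by
  rcases (potential_nonneg κ ν x).eq_or_lt with h0 | h0
  · refine ENNReal.le_of_forall_pos_le_add fun ε hε _ => ?_
    have h := entropy_transport_dirac_ge hκ ν α x (t := 1 / ε) (by positivity)
    rw [← h0] at h ⊢
    calc _ ≤ ENNReal.ofReal (1 + ν.real Set.univ - 1 / ε * 0 - 1 / (1 / ε)) + ENNReal.ofReal ε := by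
          refine le_trans (ENNReal.ofReal_le_ofReal ?_) ENNReal.ofReal_add_le
          simp
      _ ≤ _ := by
          rw [ENNReal.ofReal_coe_nnreal]
          gcongr
  · have hs := sqrt_pos.2 h0
    have h := entropy_transport_dirac_ge hκ ν α x (t := 1 / √(potential κ ν x)) (by positivity)
    refine le_trans (le_of_eq ?_) h
    congr 1
    have := mul_self_sqrt h0.le
    field_simp
    nlinarith

lemma ac_dirac_eq_smul {α : Measure X} {x : X} (h : α ≪ Measure.dirac x) :
    α = α Set.univ • Measure.dirac x := by
  have : ∀ᵐ y ∂α, y = x := h.ae_le (by rw [ae_dirac_eq]; rfl)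
  ext s hs
  by_cases hx : x ∈ s
  · simp only [Measure.smul_apply, Measure.dirac_apply' x hs, Set.indicator_of_mem hx]
    simp only [Pi.one_apply, smul_eq_mul, mul_one]
    refine measure_congr ?_
    filter_upwards [this] with y hy
    simp only [eq_iff_iff]
    rw [show (s y) = (y ∈ s) from rfl, hy]
    exact iff_of_true hx trivial
  · simp only [Measure.smul_apply, Measure.dirac_apply' x hs, Set.indicator_of_notMem hx]
    simp only [smul_zero]
    rw [measure_eq_zero_iff_ae_notMem]
    filter_upwards [this] with y hy
    rwa [hy]

lemma klDiv_smul_dirac (c : NNReal) (x : X) :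
    klDiv (c • Measure.dirac x) (Measure.dirac x) = ENNReal.ofReal (klFun c) := by
  have hac : c • Measure.dirac x ≪ Measure.dirac x := Measure.smul_absolutelyContinuous
  have hne : klDiv (c • Measure.dirac x) (Measure.dirac x) ≠ ⊤ :=
    klDiv_ne_top hac (by
      refine Integrable.smul_measure_nnreal ?_
      exact integrable_dirac (by simp))
  rw [← ENNReal.ofReal_toReal hne, toReal_klDiv_smul_left Measure.AbsolutelyContinuous.rfl
    ((integrable_congr (llr_self _)).2 (integrable_zero _ _ _))]
  rw [klDiv_self, klFun_apply]
  congr 1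
  simp
  ring

/-- A finite divergence forces the first marginal onto `x`. The plan then reduces to its second
marginal, and the two marginals share their mass. -/
lemma hkSq_dirac_ge (hκ : 0 < κ) (ν : Measure X) [IsFiniteMeasure ν] (x : X) :
    ENNReal.ofReal (1 + ν.real Set.univ - 2 * √(potential κ ν x)) ≤
      hkSq κ (Measure.dirac x) ν := by
  refine le_iInf fun γ => ?_
  by_cases hac : (γ : Measure (X × X)).map Prod.fst ≪ Measure.dirac x
  swap
  · simp [klDiv_of_not_ac hac]
  have hfst := ac_dirac_eq_smul hac
  have huniv : ((γ : Measure (X × X)).map Prod.fst) Set.univ =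
      ((γ : Measure (X × X)).map Prod.snd) Set.univ := by
    rw [Measure.map_apply measurable_fst .univ, Measure.map_apply measurable_snd .univ]
    rfl
  set α := (γ : Measure (X × X)).map Prod.snd with hα
  have hx : ∀ᵐ p ∂(γ : Measure (X × X)), p.1 = x :=
    ae_of_ae_map measurable_fst.aemeasurable (p := fun z => z = x)
      (hac.ae_le (by rw [ae_dirac_eq]; rfl))
  have hcost : (∫⁻ p, cost κ p.1 p.2 ∂(γ : Measure (X × X))) = ∫⁻ y, cost κ x y ∂α := by
    rw [hα, lintegral_map (measurable_cost x) measurable_snd]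
    refine lintegral_congr_ae ?_
    filter_upwards [hx] with p hp
    rw [hp]
  have hkl : klDiv ((γ : Measure (X × X)).map Prod.fst) (Measure.dirac x) =
      ENNReal.ofReal (klFun (α.real Set.univ)) := by
    rw [hfst, huniv, ← ENNReal.coe_toNNReal (measure_ne_top α Set.univ)]
    exact klDiv_smul_dirac _ x
  rw [hcost, hkl]
  exact entropy_transport_dirac_ge_sqrt hκ ν α x

/-- The competitor is `δ_x ⊗ t Cos² ν` with `t = 1/√P`, for which all Fenchel inequalities are
equalities; for `P = 0` it is the zero plan. -/
lemma hkSq_dirac_le (hκ : 0 < κ) (ν : Measure X) [IsFiniteMeasure ν] (x : X) :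
    hkSq κ (Measure.dirac x) ν ≤
      ENNReal.ofReal (1 + ν.real Set.univ - 2 * √(potential κ ν x)) := by
  rcases (potential_nonneg κ ν x).eq_or_lt with h0 | h0
  · refine (iInf_le _ 0).trans (le_of_eq ?_)
    simp only [FiniteMeasure.toMeasure_zero, lintegral_zero_measure, Measure.map_zero,
      klDiv_zero_left]
    rw [← h0, ENNReal.ofReal_sub _ (by simp), ENNReal.ofReal_add (by simp) (by simp)]
    simp
  set I := potential κ ν x with hI
  set t := 1 / √I with ht
  have htpos : 0 < t := by positivity
  have htI : t * I = √I := by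
    rw [ht, one_div, inv_mul_eq_div, div_sqrt]
  set g : X → ℝ := fun y => t * truncCos (dist x y / κ) ^ 2 with hg
  have hgc : Continuous g := continuous_const.mul (continuous_kernel x)
  have hg0 : ∀ y, 0 ≤ g y := fun y => by positivity
  have hgint : Integrable g ν := (integrable_kernel ν x).const_mul t
  have hgI : ∫ y, g y ∂ν = √I := by rw [hg, integral_const_mul, ← htI, hI]; rfl
  set α := ν.withDensity (fun y => ENNReal.ofReal (g y)) with hα
  have hgm : Measurable fun y => ENNReal.ofReal (g y) := hgc.measurable.ennreal_ofReal
  have hαuniv : α Set.univ = ENNReal.ofReal (√I) := by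
    rw [hα, withDensity_apply _ .univ, Measure.restrict_univ,
      ← ofReal_integral_eq_lintegral_ofReal hgint (.of_forall hg0), hgI]
  have : IsFiniteMeasure α := ⟨by rw [hαuniv]; exact ENNReal.ofReal_lt_top⟩
  have hac : α ≪ ν := withDensity_absolutelyContinuous _ _
  refine (iInf_le _ ⟨(Measure.dirac x).prod α, inferInstance⟩).trans (le_of_eq ?_)
  simp only [FiniteMeasure.toMeasure_mk]
  have hfst : ((Measure.dirac x).prod α).map Prod.fst = (√I).toNNReal • Measure.dirac x := by
    rw [Measure.map_fst_prod, hαuniv]; rfl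
  have hsnd : ((Measure.dirac x).prod α).map Prod.snd = α := by
    rw [Measure.map_snd_prod]; simp
  rw [hfst, hsnd, klDiv_smul_dirac, Real.coe_toNNReal _ (sqrt_nonneg I)]
  have hcost : ∫⁻ p, cost κ p.1 p.2 ∂((Measure.dirac x).prod α) =
      ∫⁻ y, cost κ x y * ENNReal.ofReal (g y) ∂ν := by
    have h1 : ∫⁻ p, cost κ p.1 p.2 ∂((Measure.dirac x).prod α) =
        ∫⁻ p, cost κ x p.2 ∂((Measure.dirac x).prod α) := by
      refine lintegral_congr_ae ?_
      have : ∀ᵐ p ∂((Measure.dirac x).prod α), p.1 = x := by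
        refine ae_of_ae_map measurable_fst.aemeasurable (p := fun z => z = x) ?_
        rw [hfst]
        refine Measure.ae_smul_measure ?_ _
        rw [ae_dirac_eq]; rfl
      filter_upwards [this] with p hp
      rw [hp]
    rw [h1, ← lintegral_map (measurable_cost x) measurable_snd, hsnd, hα,
      lintegral_withDensity_eq_lintegral_mul _ hgm (measurable_cost x)]
    simp [mul_comm]
  have hkl : klDiv α ν = ∫⁻ y, ENNReal.ofReal (klFun (g y)) ∂ν := by
    rw [klDiv_eq_lintegral_klFun_of_ac hac]
    refine lintegral_congr_ae ?_
    filter_upwards [Measure.rnDeriv_withDensity ν hgm] with y hy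
    rw [hα, hy, ENNReal.toReal_ofReal (hg0 y)]
  have hpt : ∀ y, cost κ x y * ENNReal.ofReal (g y) + ENNReal.ofReal (klFun (g y)) =
      ENNReal.ofReal (g y * log t + 1 - g y) ∧ 0 ≤ g y * log t + 1 - g y := by
    intro y
    by_cases h : dist x y < κ * π / 2
    · have hgy : g y = t * cos (dist x y / κ) ^ 2 := by
        rw [hg]
        simp only
        rw [truncCos_eq_cos (by positivity) ((dist_div_lt hκ).1 h)]
      have hc := neg_two_log_cos_nonneg hκ h
      have key := klFun_add_cost_eq htpos (cos_pos_of_lt hκ h)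
      rw [← hgy] at key
      have hk := klFun_nonneg (hg0 y)
      have hm := mul_nonneg (hg0 y) hc
      rw [cost_of_lt h, ← ENNReal.ofReal_mul hc, ← ENNReal.ofReal_add (by linarith) hk]
      exact ⟨by congr 1; linarith, by linarith⟩
    -- Beyond the cutoff the product is `⊤ * 0 = 0`, so the infinite cost is harmless.
    · have hgy : g y = 0 := by
        rw [hg]
        simp only
        rw [truncCos_eq_zero (not_lt.1 (mt (dist_div_lt hκ).2 h))]
        simp
      simp [hgy, klFun_zero]
  have hint : Integrable (fun y => g y * log t + 1 - g y) ν :=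
    ((hgint.mul_const _).add (integrable_const 1)).sub hgint
  rw [add_right_comm, hcost, hkl,
    ← lintegral_add_right _ (g := fun y => ENNReal.ofReal (klFun (g y)))
      (measurable_klFun.comp hgc.measurable).ennreal_ofReal,
    lintegral_congr fun y => (hpt y).1,
    ← ofReal_integral_eq_lintegral_ofReal hint (.of_forall fun y => (hpt y).2),
    ← ENNReal.ofReal_add (integral_nonneg fun y => (hpt y).2) (klFun_nonneg (sqrt_nonneg I))]
  congr 1
  rw [integral_sub (f := fun y => g y * log t + 1) ((hgint.mul_const _).add (integrable_const 1))
      hgint,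
    integral_add (hgint.mul_const _) (integrable_const 1), integral_mul_const, hgI, klFun_apply,
    ht, one_div, log_inv]
  simp
  ring

/-- The squared Hellinger-Kantorovich distance of a Dirac measure to `ν` is explicit. -/
theorem hkSq_dirac (hκ : 0 < κ) (ν : Measure X) [IsFiniteMeasure ν] (x : X) :
    hkSq κ (Measure.dirac x) ν =
      ENNReal.ofReal (1 + ν.real Set.univ - 2 * √(potential κ ν x)) :=
  (hkSq_dirac_le hκ ν x).antisymm (hkSq_dirac_ge hκ ν x)

end HKBary

/-! ### Injectivity of convolution with a measure of bounded support. -/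

namespace HKBary

open Real Filter Topology ProbabilityTheory
open scoped MeasureTheory

section Cancellation

variable {E : Type*} [NormedAddCommGroup E] [InnerProductSpace ℝ E] [MeasurableSpace E]
  [BorelSpace E]

lemma continuous_charFun_smul [SecondCountableTopology E] (μ : Measure E) [IsFiniteMeasure μ]
    (ξ : E) : Continuous fun s : ℝ => charFun μ (s • ξ) := by
  simp_rw [charFun_apply]
  refine continuous_of_dominated (bound := fun _ => 1) (fun s => ?_) (fun s => ?_)
    (integrable_const 1) (.of_forall fun x => by fun_prop)
  · exact (Continuous.aestronglyMeasurable (by fun_prop))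
  · refine .of_forall fun x => ?_
    rw [Complex.norm_exp_ofReal_mul_I]

/-- Along a ray, the characteristic function of a nonzero measure with bounded support has
isolated zeros. -/
lemma eventually_charFun_smul_ne_zero (G : Measure E) [IsFiniteMeasure G] (hG : G ≠ 0)
    {R : ℝ} (hR : ∀ᵐ z ∂G, ‖z‖ ≤ R) (ξ : E) (s₀ : ℝ) :
    ∀ᶠ s : ℝ in 𝓝[≠] s₀, charFun G (s • ξ) ≠ 0 := by
  set Y : E → ℝ := fun z => inner ℝ z ξ with hY
  have hYm : Measurable Y := (by fun_prop : Continuous Y).measurable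
  -- Bounded support makes every exponential moment finite, so the complex moment generating
  -- function is entire.
  have hset : integrableExpSet Y G = Set.univ := by
    refine Set.eq_univ_of_forall fun t => ?_
    refine Integrable.of_bound (C := exp (|t| * (R * ‖ξ‖))) (by fun_prop) ?_
    filter_upwards [hR] with z hz
    rw [norm_of_nonneg (exp_pos _).le, exp_le_exp]
    calc t * Y z ≤ |t * Y z| := le_abs_self _
      _ = |t| * |Y z| := abs_mul _ _
      _ ≤ |t| * (R * ‖ξ‖) := by
        gcongr
        exact (abs_real_inner_le_norm z ξ).trans (by gcongr)
  have han : AnalyticOnNhd ℂ (complexMGF Y G) Set.univ := fun z _ =>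
    analyticAt_complexMGF (by simp [hset])
  have hF : AnalyticOnNhd ℂ (fun s : ℂ => complexMGF Y G (s * Complex.I)) Set.univ :=
    fun z _ => AnalyticAt.fun_comp (han _ trivial) (by fun_prop)
  have heq : ∀ s : ℝ, charFun G (s • ξ) = complexMGF Y G (s * Complex.I) := by
    intro s
    rw [charFun_apply, complexMGF]
    refine integral_congr_ae (.of_forall fun z => ?_)
    simp only [hY, inner_smul_right]
    push_cast
    ring_nf
  -- Accumulating zeros would force the function to vanish identically, but at `0` it equals the
  -- mass of `G`.
  have hev : ∀ᶠ s : ℂ in 𝓝[≠] (s₀ : ℂ), complexMGF Y G (s * Complex.I) ≠ 0 := by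
    by_contra hne
    have h0 := hF.eqOn_zero_of_preconnected_of_frequently_eq_zero isPreconnected_univ
      (Set.mem_univ (s₀ : ℂ)) hne (Set.mem_univ 0)
    simp [complexMGF, measureReal_def, ENNReal.toReal_eq_zero_iff, hG] at h0
  have htend : Tendsto (fun s : ℝ => (s : ℂ)) (𝓝[≠] s₀) (𝓝[≠] (s₀ : ℂ)) := by
    refine tendsto_nhdsWithin_of_tendsto_nhds_of_eventually_within _
      (Complex.continuous_ofReal.continuousAt.mono_left nhdsWithin_le_nhds) ?_
    filter_upwards [self_mem_nhdsWithin] with s hs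
    simpa using hs
  filter_upwards [htend.eventually hev] with s hs
  rwa [heq]

/-- Convolution with a nonzero measure of bounded support is injective on finite measures. -/
theorem eq_of_conv_eq [CompleteSpace E] [SecondCountableTopology E]
    (G : Measure E) [IsFiniteMeasure G] (hG : G ≠ 0)
    {R : ℝ} (hR : ∀ᵐ z ∂G, ‖z‖ ≤ R) (μ ν : Measure E) [IsFiniteMeasure μ] [IsFiniteMeasure ν]
    (h : G ∗ μ = G ∗ ν) : μ = ν := by
  refine Measure.ext_of_charFun (funext fun ξ => ?_)
  -- `charFun G` may vanish at `ξ` itself: cancel it at `s • ξ` for `s ≠ 1` near `1`, then let `s →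
  -- 1`.
  have hμ := (continuous_charFun_smul μ ξ).continuousAt (x := 1)
  have hν := (continuous_charFun_smul ν ξ).continuousAt (x := 1)
  have := tendsto_nhds_unique_of_eventuallyEq (hμ.mono_left nhdsWithin_le_nhds)
    (hν.mono_left (nhdsWithin_le_nhds (s := {1}ᶜ))) ?_
  · simpa using this
  filter_upwards [eventually_charFun_smul_ne_zero G hG hR ξ 1] with s hs
  refine mul_left_cancel₀ hs ?_
  rw [← charFun_conv, ← charFun_conv, h]

end Cancellation

/-- Tonelli and translation invariance. With `g` the `Cos²` profile, the density on the right is the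
potential of `ν`. -/
lemma withDensity_conv {E : Type*} [NormedAddCommGroup E]
    [MeasurableSpace E] [BorelSpace E] [SecondCountableTopology E] (m : Measure E) [SFinite m]
    [m.IsAddRightInvariant] {g : E → ENNReal} (hg : Measurable g)
    (ν : Measure E) [SFinite ν] :
    (m.withDensity g) ∗ ν = m.withDensity fun x => ∫⁻ y, g (x - y) ∂ν := by
  ext s hs
  have hf : Measurable (s.indicator (1 : E → ENNReal)) := measurable_one.indicator hs
  have hmeas : Measurable fun p : E × E => g p.1 * s.indicator (1 : E → ENNReal) (p.1 + p.2) := by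
    fun_prop
  rw [← lintegral_indicator_one hs, Measure.lintegral_conv hf,
    lintegral_withDensity_eq_lintegral_mul _ hg
      (Measurable.lintegral_prod_right' (f := fun p : E × E => s.indicator 1 (p.1 + p.2))
        (by fun_prop)), withDensity_apply _ hs]
  have h1 : ∀ z, (g * fun x => ∫⁻ y, s.indicator 1 (x + y) ∂ν) z =
      ∫⁻ y, g z * s.indicator (1 : E → ENNReal) (z + y) ∂ν := fun z => by
    rw [lintegral_const_mul _ (by fun_prop)]
    rfl
  have h2 : ∀ y, ∫⁻ z, g z * s.indicator (1 : E → ENNReal) (z + y) ∂m =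
      ∫⁻ x, g (x - y) * s.indicator 1 x ∂m := fun y => by
    rw [← lintegral_add_right_eq_self (fun x => g (x - y) * s.indicator 1 x) y]
    simp
  rw [lintegral_congr h1, lintegral_lintegral_swap hmeas.aemeasurable, lintegral_congr h2,
    lintegral_lintegral_swap (by fun_prop), ← lintegral_indicator hs]
  refine lintegral_congr fun x => ?_
  by_cases hx : x ∈ s <;> simp [hx]

end HKBary

/-! ### Potentials on Euclidean space and the function `σ`. -/

namespace HKBary

open Real Filter Topology
open scoped MeasureTheory

section Euclidean

variable {d : ℕ} {κ L : ℝ}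

local notation "E" => EuclideanSpace ℝ (Fin d)

lemma continuous_profile : Continuous fun z : E => truncCos (‖z‖ / κ) ^ 2 := by fun_prop

lemma profile_eq_zero (hκ : 0 < κ) {z : E} (hz : κ * π / 2 ≤ ‖z‖) :
    truncCos (‖z‖ / κ) ^ 2 = 0 := by
  rw [truncCos_eq_zero, zero_pow two_ne_zero]
  rw [le_div_iff₀ hκ]
  linarith

lemma hasCompactSupport_profile (hκ : 0 < κ) :
    HasCompactSupport fun z : E => truncCos (‖z‖ / κ) ^ 2 := by
  refine HasCompactSupport.intro (isCompact_closedBall (0 : E) (κ * π / 2)) fun z hz => ?_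
  rw [mem_closedBall_zero_iff, not_le] at hz
  exact profile_eq_zero hκ hz.le

lemma integrable_profile (hκ : 0 < κ) : Integrable fun z : E => truncCos (‖z‖ / κ) ^ 2 :=
  continuous_profile.integrable_of_hasCompactSupport (hasCompactSupport_profile hκ)

lemma integral_profile (hκ : 0 < κ) :
    ∫ z : E, truncCos (‖z‖ / κ) ^ 2 = cosMass d * κ ^ d := by
  have h := Measure.integral_comp_smul (volume : Measure E)
    (fun z : E => truncCos ‖z‖ ^ 2) κ⁻¹
  simp only [norm_smul, norm_inv, norm_of_nonneg hκ.le, finrank_euclideanSpace,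
    Fintype.card_fin, inv_pow, inv_inv, smul_eq_mul] at h
  rw [abs_of_pos (pow_pos hκ d)] at h
  rw [cosMass, mul_comm, ← h]
  simp_rw [inv_mul_eq_div]

lemma integral_profile_pos (hκ : 0 < κ) : 0 < ∫ z : E, truncCos (‖z‖ / κ) ^ 2 :=
  continuous_profile.integral_pos_of_hasCompactSupport_nonneg_nonzero
    (hasCompactSupport_profile hκ) (fun z => by positivity) (x := 0) (by simp [truncCos_zero])

lemma potential_eq_profile (μ : Measure E) (x : E) :
    potential κ μ x = ∫ y, truncCos (‖x - y‖ / κ) ^ 2 ∂μ := by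
  simp_rw [potential, dist_eq_norm]

lemma integrable_kernel_prod (hκ : 0 < κ) (μ : Measure E) [IsFiniteMeasure μ] :
    Integrable (fun p : E × E => truncCos (‖p.1 - p.2‖ / κ) ^ 2)
      ((volume : Measure E).prod μ) := by
  rw [integrable_prod_iff' (Continuous.aestronglyMeasurable (by fun_prop))]
  refine ⟨.of_forall fun y => (integrable_profile hκ).comp_sub_right y, ?_⟩
  have : ∀ y : E, ∫ x : E, ‖truncCos (‖x - y‖ / κ) ^ 2‖ = ∫ z : E, truncCos (‖z‖ / κ) ^ 2 := by
    intro y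
    rw [← integral_sub_right_eq_self (fun z : E => truncCos (‖z‖ / κ) ^ 2) y]
    refine integral_congr_ae (.of_forall fun x => ?_)
    simp only
    rw [norm_of_nonneg (by positivity)]
  simp_rw [this]
  exact integrable_const _

lemma integrable_potential (hκ : 0 < κ) (μ : Measure E) [IsFiniteMeasure μ] :
    Integrable (potential κ μ) := by
  have := (integrable_kernel_prod hκ μ).integral_prod_left
  simpa only [← potential_eq_profile] using this

/-- By Fubini each point contributes the same kernel mass. This expresses the mass term of the
objective through the potential. -/
lemma integral_potential (hκ : 0 < κ) (μ : Measure E) [IsFiniteMeasure μ] :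
    ∫ x, potential κ μ x = cosMass d * κ ^ d * μ.real Set.univ := by
  simp_rw [potential_eq_profile]
  rw [integral_integral_swap (f := fun x y : E => truncCos (‖x - y‖ / κ) ^ 2)
    (integrable_kernel_prod hκ μ)]
  have : ∀ y : E, ∫ x : E, truncCos (‖x - y‖ / κ) ^ 2 = cosMass d * κ ^ d := by
    intro y
    rw [integral_sub_right_eq_self (fun z : E => truncCos (‖z‖ / κ) ^ 2) y, integral_profile hκ]
  simp_rw [this]
  simp [mul_comm]

lemma measurable_potential (μ : Measure E) [IsFiniteMeasure μ] :
    Measurable (potential κ μ) := by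
  have : Continuous fun p : E × E => truncCos (dist p.1 p.2 / κ) ^ 2 := by fun_prop
  exact this.stronglyMeasurable.integral_prod_right'.measurable

/-- A finite measure is determined by its potential. -/
theorem eq_of_potential_ae_eq (hκ : 0 < κ) (μ ν : Measure E) [IsFiniteMeasure μ]
    [IsFiniteMeasure ν] (h : potential κ μ =ᵐ[volume] potential κ ν) : μ = ν := by
  set g : E → ENNReal := fun z => ENNReal.ofReal (truncCos (‖z‖ / κ) ^ 2) with hg
  have hgm : Measurable g := continuous_profile.measurable.ennreal_ofReal
  set G : Measure E := volume.withDensity g with hG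
  have hGuniv : G Set.univ = ENNReal.ofReal (∫ z : E, truncCos (‖z‖ / κ) ^ 2) := by
    rw [hG, withDensity_apply _ .univ, Measure.restrict_univ,
      ofReal_integral_eq_lintegral_ofReal (integrable_profile hκ)
        (.of_forall fun z => by positivity)]
  have : IsFiniteMeasure G := ⟨by rw [hGuniv]; exact ENNReal.ofReal_lt_top⟩
  have hG0 : G ≠ 0 := by
    intro h0
    rw [h0] at hGuniv
    simpa using (ENNReal.ofReal_pos.2 (integral_profile_pos (d := d) hκ)).trans_eq hGuniv.symm
  have hR : ∀ᵐ z ∂G, ‖z‖ ≤ κ * π / 2 := by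
    rw [hG, ae_withDensity_iff hgm]
    refine .of_forall fun z hz => ?_
    by_contra hlt
    exact hz (by simp [hg, profile_eq_zero hκ (not_le.1 hlt).le])
  refine eq_of_conv_eq G hG0 hR μ ν ?_
  have hpot : ∀ (η : Measure E) [IsFiniteMeasure η] (x : E),
      ∫⁻ y, g (x - y) ∂η = ENNReal.ofReal (potential κ η x) := by
    intro η _ x
    rw [potential, ofReal_integral_eq_lintegral_ofReal (integrable_kernel η x)
      (.of_forall fun z => by positivity)]
    simp_rw [dist_eq_norm, hg]
  rw [hG, withDensity_conv _ hgm, withDensity_conv _ hgm]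
  refine withDensity_congr_ae ?_
  filter_upwards [h] with x hx
  rw [hpot, hpot, hx]

lemma sigma_eq_sqrt_potential (x : E) :
    sigma d κ L x = √(potential κ (volume.restrict (Metric.ball (0 : E) L)) x) := by
  rw [sigma, potential_eq_profile]

instance : IsFiniteMeasure (volume.restrict (Metric.ball (0 : E) L)) :=
  ⟨by simpa using measure_ball_lt_top⟩

lemma sigma_sq (x : E) :
    sigma d κ L x ^ 2 = potential κ (volume.restrict (Metric.ball (0 : E) L)) x := by
  rw [sigma_eq_sqrt_potential, sq_sqrt (potential_nonneg _ _ _)]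

lemma sigma_nonneg (x : E) : 0 ≤ sigma d κ L x := sqrt_nonneg _

/-- The radius of `Ω` exceeds `L` by exactly the range `κ π / 2` of the kernel. -/
lemma sigma_eq_zero (hκ : 0 < κ) {x : E} (hx : x ∉ domain d κ L) : sigma d κ L x = 0 := by
  rw [mem_closedBall_zero_iff, not_le] at hx
  rw [← sq_eq_zero_iff, sigma_sq, potential_eq_profile]
  refine setIntegral_eq_zero_of_forall_eq_zero fun y hy => profile_eq_zero hκ ?_
  rw [mem_ball_zero_iff] at hy
  have := norm_sub_norm_le x y
  linarith

lemma integrable_sigma_sq (hκ : 0 < κ) : Integrable fun x : E => sigma d κ L x ^ 2 := by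
  simp_rw [sigma_sq]
  exact integrable_potential hκ _

lemma setIntegral_sigma_sq (hκ : 0 < κ) :
    ∫ x in domain d κ L, sigma d κ L x ^ 2 =
      cosMass d * κ ^ d * volume.real (Metric.ball (0 : E) L) := by
  rw [setIntegral_eq_integral_of_forall_compl_eq_zero fun x hx => by simp [sigma_eq_zero hκ hx]]
  simp_rw [sigma_sq]
  rw [integral_potential hκ]
  simp

lemma cosMass_mul_pow_pos (hκ : 0 < κ) : 0 < cosMass d * κ ^ d := by
  rw [← integral_profile hκ]
  exact integral_profile_pos hκ

lemma measurable_sigma : Measurable (sigma d κ L) := by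
  have : sigma d κ L = fun x => √(potential κ (volume.restrict (Metric.ball (0 : E) L)) x) :=
    funext sigma_eq_sqrt_potential
  rw [this]
  exact (measurable_potential _).sqrt

lemma integrable_sqrt_potential_mul_sigma (hκ : 0 < κ) (μ : Measure E) [IsFiniteMeasure μ] :
    Integrable (fun x => √(potential κ μ x) * sigma d κ L x) := by
  refine ((integrable_potential hκ μ).add (integrable_sigma_sq (L := L) hκ)).mono'
    ((measurable_potential μ).sqrt.mul measurable_sigma).aestronglyMeasurable
    (.of_forall fun x => ?_)
  rw [norm_of_nonneg (mul_nonneg (sqrt_nonneg _) (sigma_nonneg x))]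
  simp only [Pi.add_apply]
  nlinarith [sq_nonneg (√(potential κ μ x) - sigma d κ L x), sq_sqrt (potential_nonneg κ μ x),
    sq_nonneg (sigma d κ L x), potential_nonneg κ μ x]

lemma integrableOn_sigma (hκ : 0 < κ) : IntegrableOn (sigma d κ L) (domain d κ L) := by
  have hfin : IsFiniteMeasure (volume.restrict (domain d κ L)) :=
    ⟨by simpa using measure_closedBall_lt_top⟩
  refine ((integrable_const (1 : ℝ)).add (integrable_sigma_sq (L := L) hκ).integrableOn).mono'
    measurable_sigma.aestronglyMeasurable (.of_forall fun x => ?_)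
  rw [norm_of_nonneg (sigma_nonneg x)]
  simp only [Pi.add_apply]
  nlinarith [sq_nonneg (sigma d κ L x - 1)]

lemma volume_real_ball_pos (hL : 0 < L) : 0 < volume.real (Metric.ball (0 : E) L) :=
  ENNReal.toReal_pos (Metric.measure_ball_pos _ _ hL).ne' measure_ball_lt_top.ne

lemma setIntegral_sigma_pos (hκ : 0 < κ) (hL : 0 < L) :
    0 < ∫ x in domain d κ L, sigma d κ L x := by
  refine (integral_nonneg sigma_nonneg).lt_of_ne fun h0 => ?_
  have hz := (integral_eq_zero_iff_of_nonneg sigma_nonneg (integrableOn_sigma hκ)).1 h0.symm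
  have h2 := setIntegral_sigma_sq (d := d) (L := L) hκ
  rw [integral_eq_zero_of_ae (by filter_upwards [hz] with x hx; simp [hx])] at h2
  exact (mul_pos (cosMass_mul_pow_pos hκ) (volume_real_ball_pos hL)).ne h2

lemma normConst_pos (hκ : 0 < κ) (hL : 0 < L) : 0 < normConst d κ L :=
  one_div_pos.2 (setIntegral_sigma_pos hκ hL)

/-! ### Completing the square and uniqueness on `ℝ^d`. -/

/-- The barycenter objective of a measure on `ℝ^d`, in closed form. -/
noncomputable def energy (d : ℕ) (κ L : ℝ) (μ : Measure (EuclideanSpace ℝ (Fin d))) : ℝ :=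
  1 + μ.real Set.univ -
    2 * ∫ x in domain d κ L, √(potential κ μ x) * (normConst d κ L * sigma d κ L x)

/-- The deficit of the energy is a sum of two nonnegative terms. -/
lemma energy_eq (hκ : 0 < κ) (μ : Measure E) [IsFiniteMeasure μ] :
    energy d κ L μ =
      1 - (cosMass d * κ ^ d * normConst d κ L) ^ 2 * volume.real (Metric.ball (0 : E) L) +
      (cosMass d * κ ^ d)⁻¹ * (∫ x in (domain d κ L)ᶜ, potential κ μ x) +
      (cosMass d * κ ^ d)⁻¹ * ∫ x in domain d κ L,
        (√(potential κ μ x) - cosMass d * κ ^ d * normConst d κ L * sigma d κ L x) ^ 2 := by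
  have hK := cosMass_mul_pow_pos (d := d) hκ
  set K := cosMass d * κ ^ d with hKdef
  set a := normConst d κ L
  -- The total integral of the potential is `K` times the mass; the part inside `Ω` enters the
  -- square, the part outside remains as a penalty.
  have hsplit := integral_add_compl (s := domain d κ L) Metric.isClosed_closedBall.measurableSet
    (integrable_potential hκ μ)
  rw [integral_potential hκ μ] at hsplit
  have hsq : ∫ x in domain d κ L, (√(potential κ μ x) - K * a * sigma d κ L x) ^ 2 =
      (∫ x in domain d κ L, potential κ μ x) -
      2 * K * a * (∫ x in domain d κ L, √(potential κ μ x) * sigma d κ L x) +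
      (K * a) ^ 2 * ∫ x in domain d κ L, sigma d κ L x ^ 2 := by
    have hi1 := (integrable_potential hκ μ).integrableOn (s := domain d κ L)
    have hi2 := ((integrable_sqrt_potential_mul_sigma (L := L) hκ μ).integrableOn
      (s := domain d κ L)).const_mul (2 * K * a)
    have hi3 := ((integrable_sigma_sq (L := L) hκ).integrableOn
      (s := domain d κ L)).const_mul ((K * a) ^ 2)
    rw [← integral_const_mul, ← integral_const_mul, ← integral_sub hi1 hi2,
      ← integral_add (f := fun x => potential κ μ x -
        2 * K * a * (√(potential κ μ x) * sigma d κ L x)) (hi1.sub hi2) hi3]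
    refine integral_congr_ae (.of_forall fun x => ?_)
    simp only
    have := sq_sqrt (potential_nonneg κ μ x)
    linear_combination this
  have hcross : ∫ x in domain d κ L, √(potential κ μ x) * (a * sigma d κ L x) =
      a * ∫ x in domain d κ L, √(potential κ μ x) * sigma d κ L x := by
    rw [← integral_const_mul]
    exact integral_congr_ae (.of_forall fun x => by ring)
  rw [hsq, setIntegral_sigma_sq hκ, energy, hcross, ← hKdef]
  rw [← hKdef] at hsplit
  field_simp
  linear_combination -hsplit

lemma energy_ge (hκ : 0 < κ) (μ : Measure E) [IsFiniteMeasure μ] :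
    1 - (cosMass d * κ ^ d * normConst d κ L) ^ 2 * volume.real (Metric.ball (0 : E) L) ≤
      energy d κ L μ := by
  have hK := (cosMass_mul_pow_pos (d := d) hκ).le
  have h1 : 0 ≤ ∫ x in (domain d κ L)ᶜ, potential κ μ x :=
    integral_nonneg fun x => potential_nonneg κ μ x
  have h2 : 0 ≤ ∫ x in domain d κ L,
      (√(potential κ μ x) - cosMass d * κ ^ d * normConst d κ L * sigma d κ L x) ^ 2 :=
    integral_nonneg fun x => by positivity
  rw [energy_eq hκ]
  have := mul_nonneg (inv_nonneg.2 hK) h1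
  have := mul_nonneg (inv_nonneg.2 hK) h2
  linarith

/-- The minimizer, as a measure on `ℝ^d`. -/
noncomputable def optimalMeasure (d : ℕ) (κ L : ℝ) : Measure (EuclideanSpace ℝ (Fin d)) :=
  ENNReal.ofReal (cosMass d ^ 2 * κ ^ (2 * d) * normConst d κ L ^ 2) •
    volume.restrict (Metric.ball 0 L)

instance : IsFiniteMeasure (optimalMeasure d κ L) := by
  unfold optimalMeasure
  exact Measure.smul_finite _ ENNReal.ofReal_ne_top

/-- The factor `C_d² κ^{2d} a²` is `(K a)²`, exactly what makes the square in `energy_eq` vanish. -/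
lemma potential_optimalMeasure (x : E) :
    potential κ (optimalMeasure d κ L) x =
      (cosMass d * κ ^ d * normConst d κ L * sigma d κ L x) ^ 2 := by
  rw [mul_pow, sigma_sq, optimalMeasure, potential, integral_smul_measure,
    ENNReal.toReal_ofReal (by rw [pow_mul' κ]; positivity), potential, smul_eq_mul]
  ring

lemma sqrt_potential_optimalMeasure (hκ : 0 < κ) (hL : 0 < L) (x : E) :
    √(potential κ (optimalMeasure d κ L) x) =
      cosMass d * κ ^ d * normConst d κ L * sigma d κ L x := by
  rw [potential_optimalMeasure, sqrt_sq]
  exact mul_nonneg (mul_pos (cosMass_mul_pow_pos hκ) (normConst_pos hκ hL)).le (sigma_nonneg x)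

lemma energy_optimalMeasure (hκ : 0 < κ) (hL : 0 < L) :
    energy d κ L (optimalMeasure d κ L) =
      1 - (cosMass d * κ ^ d * normConst d κ L) ^ 2 * volume.real (Metric.ball (0 : E) L) := by
  rw [energy_eq hκ]
  have h1 : ∫ x in (domain d κ L)ᶜ, potential κ (optimalMeasure d κ L) x = 0 :=
    setIntegral_eq_zero_of_forall_eq_zero fun x hx => by
      simp [potential_optimalMeasure, sigma_eq_zero hκ hx]
  simp [h1, sqrt_potential_optimalMeasure hκ hL]

/-- The minimizer of the energy is unique. -/
theorem eq_optimalMeasure_of_energy_le (hκ : 0 < κ) (hL : 0 < L) (μ : Measure E)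
    [IsFiniteMeasure μ] (h : energy d κ L μ ≤ energy d κ L (optimalMeasure d κ L)) :
    μ = optimalMeasure d κ L := by
  have hD : MeasurableSet (domain d κ L) := Metric.isClosed_closedBall.measurableSet
  have hK := inv_pos.2 (cosMass_mul_pow_pos (d := d) hκ)
  have h1 : 0 ≤ ∫ x in (domain d κ L)ᶜ, potential κ μ x :=
    integral_nonneg fun x => potential_nonneg κ μ x
  have h2 : 0 ≤ ∫ x in domain d κ L,
      (√(potential κ μ x) - cosMass d * κ ^ d * normConst d κ L * sigma d κ L x) ^ 2 :=
    integral_nonneg fun x => by positivity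
  rw [energy_optimalMeasure hκ hL, energy_eq hκ] at h
  have h1' : ∫ x in (domain d κ L)ᶜ, potential κ μ x = 0 := by
    have := mul_nonneg hK.le h2
    nlinarith
  have h2' : ∫ x in domain d κ L,
      (√(potential κ μ x) - cosMass d * κ ^ d * normConst d κ L * sigma d κ L x) ^ 2 = 0 := by
    have := mul_nonneg hK.le h1
    nlinarith
  have hint : IntegrableOn (fun x : E =>
      (√(potential κ μ x) - cosMass d * κ ^ d * normConst d κ L * sigma d κ L x) ^ 2)
      (domain d κ L) := by
    -- Dominated through `(u - v)² ≤ 2u² + 2v²`. Integrability is essential: otherwise a zero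
    -- Bochner integral would carry no information.
    refine Integrable.mono'
      (((integrable_potential hκ μ).const_mul 2).integrableOn.add
        ((integrable_sigma_sq (L := L) hκ).const_mul
          (2 * (cosMass d * κ ^ d * normConst d κ L) ^ 2)).integrableOn (s := domain d κ L)) ?_ (.of_forall fun x => ?_)
    · exact (((measurable_potential μ).sqrt.sub
        (measurable_sigma.const_mul _)).pow_const 2).aestronglyMeasurable
    · rw [norm_of_nonneg (by positivity)]
      simp only [Pi.add_apply]
      nlinarith [sq_nonneg (√(potential κ μ x) +
        cosMass d * κ ^ d * normConst d κ L * sigma d κ L x), sq_sqrt (potential_nonneg κ μ x)]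
  rw [integral_eq_zero_iff_of_nonneg (fun x => potential_nonneg κ μ x)
    (integrable_potential hκ μ).integrableOn] at h1'
  rw [integral_eq_zero_iff_of_nonneg (fun x => by positivity) hint] at h2'
  refine eq_of_potential_ae_eq hκ _ _ ?_
  filter_upwards [(ae_restrict_iff' hD).1 h2', (ae_restrict_iff' hD.compl).1 h1'] with x hx hx'
  -- Inside `Ω` the square vanishes; outside, the penalty makes the potential zero. Injectivity
  -- needs equality on both parts.
  by_cases hxD : x ∈ domain d κ L
  · have := sub_eq_zero.1 (sq_eq_zero_iff.1 (hx hxD))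
    rw [potential_optimalMeasure, ← this, sq_sqrt (potential_nonneg κ μ x)]
  · rw [hx' hxD, potential_optimalMeasure, sigma_eq_zero hκ hxD]
    simp

/-! ### Transfer between `Ω` and `ℝ^d`, and conclusion. -/

lemma measurableSet_domain : MeasurableSet (domain d κ L) :=
  Metric.isClosed_closedBall.measurableSet

lemma map_val_lebesgue : (lebesgue d κ L).map Subtype.val = volume.restrict (domain d κ L) :=
  map_comap_subtype_coe measurableSet_domain _

lemma map_val_diffuseMeasure (hκ : 0 < κ) :
    (diffuseMeasure d κ L).map Subtype.val = optimalMeasure d κ L := by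
  have hsub : Metric.ball (0 : E) L ∩ domain d κ L = Metric.ball 0 L :=
    Set.inter_eq_left.2 (Metric.ball_subset_closedBall.trans
      (Metric.closedBall_subset_closedBall (by have := pi_pos; nlinarith)))
  rw [diffuseMeasure, Measure.map_smul, optimalMeasure]
  congr 1
  have := Measure.restrict_map (μ := lebesgue d κ L) measurable_subtype_coe
    (measurableSet_ball (x := (0 : E)) (ε := L))
  rw [map_val_lebesgue, Measure.restrict_restrict measurableSet_ball, hsub] at this
  exact this.symm

lemma map_val_injective {μ ν : Measure (domain d κ L)}
    (h : μ.map Subtype.val = ν.map Subtype.val) : μ = ν := by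
  have he := MeasurableEmbedding.subtype_coe (measurableSet_domain (d := d) (κ := κ) (L := L))
  rw [← he.comap_map μ, h, he.comap_map]

lemma isProbabilityMeasure_rho (hκ : 0 < κ) (hL : 0 < L) : IsProbabilityMeasure (rho d κ L) := by
  constructor
  rw [rho, withDensity_apply _ .univ, Measure.restrict_univ, lebesgue,
    lintegral_subtype_comap measurableSet_domain
      (fun x : E => ENNReal.ofReal (normConst d κ L * sigma d κ L x)),
    ← ofReal_integral_eq_lintegral_ofReal ((integrableOn_sigma hκ).const_mul _)
      (.of_forall fun x => mul_nonneg (normConst_pos hκ hL).le (sigma_nonneg x)),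
    integral_const_mul, normConst, one_div_mul_cancel (setIntegral_sigma_pos hκ hL).ne',
    ENNReal.ofReal_one]

lemma integral_rho (hκ : 0 < κ) (hL : 0 < L) (f : E → ℝ) :
    ∫ x : domain d κ L, f x ∂(rho d κ L) =
      ∫ x in domain d κ L, f x * (normConst d κ L * sigma d κ L x) := by
  have hm : Measurable fun x : domain d κ L =>
      ENNReal.ofReal (normConst d κ L * sigma d κ L x) :=
    ((measurable_sigma.comp measurable_subtype_coe).const_mul _).ennreal_ofReal
  rw [rho, integral_withDensity_eq_integral_toReal_smul hm
    (.of_forall fun x => ENNReal.ofReal_lt_top), lebesgue,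
    ← integral_subtype_comap measurableSet_domain]
  refine integral_congr_ae (.of_forall fun x => ?_)
  simp only [smul_eq_mul]
  rw [ENNReal.toReal_ofReal (mul_nonneg (normConst_pos hκ hL).le (sigma_nonneg _)), mul_comm]

lemma potential_map_val (ν : Measure (domain d κ L)) (x : domain d κ L) :
    potential κ (ν.map Subtype.val) (x : E) = potential κ ν x := by
  rw [potential, integral_map measurable_subtype_coe.aemeasurable
    (continuous_kernel (κ := κ) (x : E)).aestronglyMeasurable]
  rfl

/-- The objective of a finite measure on `Ω` is the energy of its image in `ℝ^d`. -/
lemma objective_eq (hκ : 0 < κ) (hL : 0 < L) (ν : Measure (domain d κ L)) [IsFiniteMeasure ν] :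
    objective κ (rho d κ L) ν = ENNReal.ofReal (energy d κ L (ν.map Subtype.val)) ∧
      0 ≤ energy d κ L (ν.map Subtype.val) := by
  have := isProbabilityMeasure_rho (d := d) hκ hL
  have hν : (ν.map Subtype.val).real Set.univ = ν.real Set.univ := by
    simp [measureReal_def, Measure.map_apply measurable_subtype_coe]
  set f : E → ℝ := fun x => √(potential κ (ν.map Subtype.val) x) with hf
  have hfm : Measurable fun x : domain d κ L => f x :=
    (measurable_potential _).sqrt.comp measurable_subtype_coe
  have h0 : ∀ x : domain d κ L, 0 ≤ 1 + ν.real Set.univ - 2 * f x := fun x => by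
    have := two_sqrt_potential_le (κ := κ) ν x
    rw [hf]
    simp only
    rw [potential_map_val]
    linarith
  have hfi : Integrable (fun x : domain d κ L => f x) (rho d κ L) := by
    refine Integrable.of_bound (C := 1 + ν.real Set.univ) hfm.aestronglyMeasurable
      (.of_forall fun x => ?_)
    have hx : 0 ≤ f x := sqrt_nonneg _
    rw [norm_of_nonneg hx]
    linarith [h0 x]
  have hI : Integrable (fun x : domain d κ L => 1 + ν.real Set.univ - 2 * f x) (rho d κ L) :=
    (integrable_const _).sub (hfi.const_mul 2)
  have hE : energy d κ L (ν.map Subtype.val) =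
      ∫ x : domain d κ L, (1 + ν.real Set.univ - 2 * f x) ∂(rho d κ L) := by
    rw [integral_sub (integrable_const _) (hfi.const_mul 2), integral_const_mul,
      integral_rho hκ hL f, energy, hν]
    simp [hf]
  refine ⟨?_, hE ▸ integral_nonneg h0⟩
  rw [hE, ofReal_integral_eq_lintegral_ofReal hI (.of_forall h0)]
  refine lintegral_congr fun x => ?_
  rw [hkSq_dirac hκ, hf]
  simp only [potential_map_val]

lemma isFiniteMeasure_diffuseMeasure (hκ : 0 < κ) : IsFiniteMeasure (diffuseMeasure d κ L) := by
  constructor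
  have : (diffuseMeasure d κ L).map Subtype.val Set.univ < ⊤ := by
    rw [map_val_diffuseMeasure hκ]
    exact measure_lt_top _ _
  rwa [Measure.map_apply measurable_subtype_coe .univ] at this

lemma isMinimizer_diffuseMeasure (hκ : 0 < κ) (hL : 0 < L) :
    IsMinimizer κ (rho d κ L) (diffuseMeasure d κ L) := by
  have := isFiniteMeasure_diffuseMeasure (d := d) (L := L) hκ
  refine ⟨this, fun ν hν => ?_⟩
  rw [(objective_eq hκ hL _).1, (objective_eq hκ hL ν).1, map_val_diffuseMeasure hκ,
    energy_optimalMeasure hκ hL]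
  exact ENNReal.ofReal_le_ofReal (energy_ge hκ _)

lemma IsMinimizer.eq_diffuseMeasure (hκ : 0 < κ) (hL : 0 < L) {ν : Measure (domain d κ L)}
    (h : IsMinimizer κ (rho d κ L) ν) : ν = diffuseMeasure d κ L := by
  have hfin := isFiniteMeasure_diffuseMeasure (d := d) (L := L) hκ
  have := h.1
  have hle := h.2 _ hfin
  obtain ⟨h1, h2⟩ := objective_eq hκ hL (diffuseMeasure d κ L)
  rw [(objective_eq hκ hL ν).1, h1, ENNReal.ofReal_le_ofReal_iff h2,
    map_val_diffuseMeasure hκ] at hle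
  refine map_val_injective ?_
  rw [map_val_diffuseMeasure hκ]
  exact eq_optimalMeasure_of_energy_le hκ hL _ hle

lemma not_isDiscrete_diffuseMeasure (hd : 1 ≤ d) (hκ : 0 < κ) (hL : 0 < L) :
    ¬ IsDiscrete (diffuseMeasure d κ L) := by
  rintro ⟨S, hS, hS0⟩
  -- Here `d ≥ 1` matters: Lebesgue measure has no atoms only in positive dimension.
  have : Nonempty (Fin d) := ⟨⟨0, hd⟩⟩
  have hc : 0 < cosMass d ^ 2 * κ ^ (2 * d) * normConst d κ L ^ 2 := by
    have := mul_pos (cosMass_mul_pow_pos (d := d) hκ) (normConst_pos (d := d) hκ hL)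
    calc 0 < (cosMass d * κ ^ d * normConst d κ L) ^ 2 := by positivity
      _ = _ := by ring
  have he := MeasurableEmbedding.subtype_coe (measurableSet_domain (d := d) (κ := κ) (L := L))
  have hSm : diffuseMeasure d κ L S = 0 := by
    have h0 : optimalMeasure d κ L (Subtype.val '' S) = 0 := by
      rw [optimalMeasure, Measure.smul_apply, (hS.image _).measure_zero, smul_zero]
    rw [← map_val_diffuseMeasure hκ, he.map_apply,
      Set.preimage_image_eq _ Subtype.val_injective] at h0
    exact h0
  have huniv : optimalMeasure d κ L Set.univ = 0 := by
    rw [← map_val_diffuseMeasure hκ, he.map_apply, Set.preimage_univ, ← Set.union_compl_self S]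
    exact measure_union_null hSm hS0
  rw [optimalMeasure, Measure.smul_apply, Measure.restrict_apply_univ, smul_eq_mul,
    mul_eq_zero] at huniv
  rcases huniv with h | h
  · exact (ENNReal.ofReal_pos.2 hc).ne' h
  · exact (Metric.measure_ball_pos volume (0 : E) hL).ne' h

end Euclidean

end HKBary
theorem mainTheorem9 (d : ℕ) (hd : 1 ≤ d) (κ : ℝ) (hκ : 0 < κ) (L : ℝ) (hL : 0 < L) :
    IsProbabilityMeasure (HKBary.rho d κ L) ∧
    HKBary.IsMinimizer κ (HKBary.rho d κ L) (HKBary.diffuseMeasure d κ L) ∧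
    (∀ ν : Measure (HKBary.domain d κ L),
      HKBary.IsMinimizer κ (HKBary.rho d κ L) ν → ν = HKBary.diffuseMeasure d κ L) ∧
    ¬ ∃ ν : Measure (HKBary.domain d κ L),
      HKBary.IsMinimizer κ (HKBary.rho d κ L) ν ∧ HKBary.IsDiscrete ν := by
  refine ⟨HKBary.isProbabilityMeasure_rho hκ hL, HKBary.isMinimizer_diffuseMeasure hκ hL,
    fun ν hν => hν.eq_diffuseMeasure hκ hL, ?_⟩
  rintro ⟨ν, hν, hdisc⟩
  rw [hν.eq_diffuseMeasure hκ hL] at hdisc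
  exact HKBary.not_isDiscrete_diffuseMeasure hd hκ hL hdisc
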